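/- Let $\epsilon\in(0,\frac16)$ be a real number, and write $\{x\}=x-\lfloor x\rfloor$ for the fractional part of $x$. Then there exist a finite set $\Gamma_0$ of positive integers and a positive integer $M$, both depending only on $\epsilon$, such that the following holds. Let $r$ be a positive integer and let $a_1,a_2,a_3,a_4,e$ be integers such that: - $\gcd(a_1,r)=\gcd(a_2,r)=\gcd(a_3,r)=1$ and $\gcd(a_4,r)=\gcd(e,r)$; - $a_1+a_2+a_3+a_4-e\equiv 1 \pmod r$; - at least one of the following holds: (i) $a_1+a_2-e\equiv 0\pmod r$; (ii) $2a_4-e\equiv 0\pmod r$; (iii) $2a_1-e\equiv 0\pmod r$ and $\gcd(a_4,r)=\gcd(e,r)\le 2$. Let $\Gamma\subseteq\{1,\dots,r-1\}$ be a non-empty set such that for every $k\in\Gamma$ $$\frac kr\in\Big[\frac56+\epsilon,1\Big)\quad\text{and}\quad \sum_{i=1}^4\Big\{\frac{a_ik}{r}\Big\}=\Big\{\frac{ek}{r}\Big\}+\frac kr,$$ and for every $k\in\{1,\dots,r-1\}\setminus\Gamma$ $$\sum_{i=1}^4\Big\{\frac{a_ik}{r}\Big\}>\Big\{\frac{ek}{r}\Big\}+1.$$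 Then either $r\in\Gamma_0$, or all of the following hold: 1. $2a_4-e\equiv 0\pmod r$ and $a_1+a_2-e\not\equiv 0\pmod r$; 2. $7\le\gcd(e,r)\le M$; 3. $r\mid ek$ for every $k\in\Gamma$. -/

import Mathlib

/-! Put $F(k)=\sum_j \mathrm{saw}(kc_j/r)$ with $c=(a_1,a_2,a_3,a_4,-e,-1)$. The gcd conditions and
the congruence make $F(k)$ the integer $\sum\{a_ik/r\}-\{ek/r\}-k/r$ minus $1$, so $F=-1$ on
$\Gamma$ and $F\ge 0$ off $\Gamma$. As $F$ is odd and $r$-periodic, it vanishes for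
$k/r\in(\frac16-\epsilon,\frac56+\epsilon)$ and is $\le 0$ for $k/r>\frac12$. For all large $r$ this
forces $F=0$ on the upper half (`exists_bound_saw_sum`), so no $k$ can lie in $\Gamma$ and $r$ is
bounded.

The bound is by compactness. Given counterexamples with $r_n\to\infty$, take an ultrafilter limit:
multiples of $c_n/r_n$ become dense in the subgroup of the torus cut out by the limiting linear
relations (`eventually_exists_approx`), so both sign statements pass to that subgroup (`hzero`,
`hnonpos` in `not_sequence_of_saw_sums`). The subgroup contains a line on which the last coordinate
moves, since $r_n\to\infty$, and it contains the multiples of a bad point $b$ of some $n$. Averaging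
the saw sum over the finitely many translates with last coordinate $s$ modulo $1$ gives $\sum_j
D_j\,\mathrm{saw}(P_js)$ (`exists_sum_sum_saw`). This is zero for $s$ in the middle, hence for every
$s$ (`saw_sum_eq_zero_of_middle`): each frequency $P\ge2$ has a jump in $[\frac16,\frac56]$. At
$s=b_o$, however, all terms are $\le0$ and that of $b$ is negative. -/

open Filter Topology

/-! ### Local behaviour of the sawtooth function. -/

/-- The sawtooth function: `{x} - 1/2` off the integers and `0` on the integers. -/
noncomputable def saw (x : ℝ) : ℝ := if Int.fract x = 0 then 0 else Int.fract x - 1 / 2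

theorem saw_add_int (x : ℝ) (z : ℤ) : saw (x + z) = saw x := by
  simp [saw, Int.fract_add_intCast]

theorem saw_int (z : ℤ) : saw z = 0 := by simp [saw]

theorem saw_zero : saw 0 = 0 := by simp [saw]

theorem saw_of_mem_Ioo {x : ℝ} (h0 : 0 < x) (h1 : x < 1) : saw x = x - 1 / 2 := by
  have : Int.fract x = x := Int.fract_eq_self.2 ⟨h0.le, h1⟩
  simp [saw, this, h0.ne']

theorem fract_ne_zero_of_ne_int {x : ℝ} (hx : ∀ z : ℤ, x ≠ z) : Int.fract x ≠ 0 := by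
  intro h
  obtain ⟨z, hz⟩ := Int.fract_eq_zero_iff.1 h
  exact hx z hz.symm

theorem saw_neg (x : ℝ) : saw (-x) = -saw x := by
  by_cases h : Int.fract x = 0
  · have : Int.fract (-x) = 0 := Int.fract_neg_eq_zero.2 h
    simp [saw, h, this]
  · have h' : Int.fract (-x) ≠ 0 := fun h2 => h (Int.fract_neg_eq_zero.1 h2)
    rw [saw, saw, if_neg h, if_neg h', Int.fract_neg h]
    ring

theorem saw_eventually_eq {x : ℝ} (hx : ∀ z : ℤ, x ≠ z) :
    ∀ᶠ y in 𝓝 x, saw y = saw x + (y - x) := by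
  have h0 : Int.fract x ≠ 0 := fract_ne_zero_of_ne_int hx
  have h1 : 0 < Int.fract x := lt_of_le_of_ne (Int.fract_nonneg x) (Ne.symm h0)
  have h2 : Int.fract x < 1 := Int.fract_lt_one x
  have hfx : (⌊x⌋ : ℝ) + Int.fract x = x := Int.floor_add_fract x
  have hm : x ∈ Set.Ioo (⌊x⌋ : ℝ) (⌊x⌋ + 1) := ⟨by linarith, by linarith⟩
  filter_upwards [isOpen_Ioo.mem_nhds hm] with y hy
  have e : saw y = saw (y - ⌊x⌋) := by
    rw [← saw_add_int (y - ⌊x⌋) ⌊x⌋]; congr 1; ring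
  have e' : saw x = saw (x - ⌊x⌋) := by
    rw [← saw_add_int (x - ⌊x⌋) ⌊x⌋]; congr 1; ring
  rw [e, e', saw_of_mem_Ioo (by linarith [hy.1]) (by linarith [hy.2]),
    saw_of_mem_Ioo (by linarith [hm.1]) (by linarith [hm.2])]
  ring

theorem tendsto_add_mul_nhds (x c : ℝ) : Tendsto (fun t : ℝ => x + c * t) (𝓝 0) (𝓝 x) := by
  have : Continuous (fun t : ℝ => x + c * t) := by fun_prop
  simpa using this.tendsto 0

/-- The value $0$ at an integer is the mean of the one-sided limits, so symmetric averaging is exact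
even at a jump. This is what later extends statements from generic points to all points. -/
theorem saw_add_saw_sub_eventually (x c : ℝ) :
    ∀ᶠ t in 𝓝 (0 : ℝ), saw (x + c * t) + saw (x - c * t) = 2 * saw x := by
  by_cases hx : ∀ z : ℤ, x ≠ z
  · have h1 := (tendsto_add_mul_nhds x c).eventually (saw_eventually_eq hx)
    have h2 := (tendsto_add_mul_nhds x (-c)).eventually (saw_eventually_eq hx)
    filter_upwards [h1, h2] with t ht1 ht2
    have : x - c * t = x + -c * t := by ring
    rw [ht1, this, ht2]; ring
  · push Not at hx
    obtain ⟨z, rfl⟩ := hx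
    refine Eventually.of_forall fun t => ?_
    have e1 : saw ((z : ℝ) + c * t) = saw (c * t) := by rw [add_comm, saw_add_int]
    have e2 : saw ((z : ℝ) - c * t) = -saw (c * t) := by
      rw [sub_eq_add_neg, add_comm, saw_add_int, saw_neg]
    rw [e1, e2, saw_int]; ring

open Classical in
theorem saw_add_sub_saw_sub_eventually (x : ℝ) {c : ℝ} (hc : 0 < c) :
    ∀ᶠ t in 𝓝[>] (0 : ℝ), saw (x + c * t) - saw (x - c * t)
      = 2 * c * t - (if ∃ z : ℤ, x = z then 1 else 0) := by
  by_cases hx : ∃ z : ℤ, x = z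
  · rw [if_pos hx]
    obtain ⟨z, rfl⟩ := hx
    have h1 : ∀ᶠ t in 𝓝[>] (0 : ℝ), t < 1 / c :=
      nhdsWithin_le_nhds (isOpen_Iio.mem_nhds (by simpa using hc))
    filter_upwards [h1, self_mem_nhdsWithin] with t ht ht0
    have ht0 : 0 < t := ht0
    have hct : c * t < 1 := by rw [lt_div_iff₀ hc] at ht; linarith
    have e1 : saw ((z : ℝ) + c * t) = saw (c * t) := by rw [add_comm, saw_add_int]
    have e2 : saw ((z : ℝ) - c * t) = -saw (c * t) := by
      rw [sub_eq_add_neg, add_comm, saw_add_int, saw_neg]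
    rw [e1, e2, saw_of_mem_Ioo (mul_pos hc ht0) hct]; ring
  · rw [if_neg hx]
    push Not at hx
    have h1 := (tendsto_add_mul_nhds x c).eventually (saw_eventually_eq hx)
    have h2 := (tendsto_add_mul_nhds x (-c)).eventually (saw_eventually_eq hx)
    filter_upwards [nhdsWithin_le_nhds h1, nhdsWithin_le_nhds h2] with t ht1 ht2
    have : x - c * t = x + -c * t := by ring
    rw [ht1, this, ht2]; ring

/-! ### Independence of the dilates of the sawtooth, detected in the middle interval. -/

/-- Integers just below $b/2$ serve, chosen according to $b$ modulo $4$. The constants are sharp: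
for $b=6$ only $\frac16$ and $\frac56$ are available, which is where the threshold $\frac56$ of the
theorem comes from. -/
theorem exists_coprime_mem_middle {b : ℕ} (hb : 2 ≤ b) :
    ∃ a : ℕ, a.Coprime b ∧ b ≤ 6 * a ∧ 6 * a ≤ 5 * b := by
  rcases Nat.even_or_odd' b with ⟨m, rfl | rfl⟩
  · rcases Nat.even_or_odd' m with ⟨n, rfl | rfl⟩
    · refine ⟨2 * n - 1, ?_, by omega, by omega⟩
      obtain ⟨l, rfl⟩ : ∃ l, n = l + 1 := ⟨n - 1, by omega⟩
      have : 2 * (2 * (l + 1)) = 2 * (2 * (l + 1) - 1) + 2 := by omega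
      rw [this, Nat.coprime_mul_right_add_right]
      exact (Nat.coprime_two_right).2 ⟨l, by omega⟩
    · rcases Nat.eq_zero_or_pos n with rfl | hn
      · exact ⟨1, by simp, by omega, by omega⟩
      · refine ⟨2 * n - 1, ?_, by omega, by omega⟩
        have : 2 * (2 * n + 1) = 2 * (2 * n - 1) + 2 ^ 2 := by omega
        rw [this, Nat.coprime_mul_right_add_right]
        exact Nat.Coprime.pow_right _ ((Nat.coprime_two_right).2 ⟨n - 1, by omega⟩)
  · refine ⟨m, ?_, by omega, by omega⟩
    rw [Nat.coprime_mul_right_add_right]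
    exact Nat.coprime_one_right m

/-- A combination of the functions `s ↦ saw (P * s)` that vanishes for `s` in the middle part
`(1/6 - ε, 5/6 + ε)` of the unit interval has vanishing coefficients. -/
theorem coeff_eq_zero_of_saw_sum_eq_zero {ε : ℝ} (hε : 0 < ε) (B : ℕ) (e : ℕ → ℝ)
    (h : ∀ s : ℝ, (∀ z : ℤ, s ≠ z) → |saw s| < 1 / 3 + ε →
      ∑ P ∈ Finset.range (B + 1), e P * saw (P * s) = 0) :
    ∀ P ∈ Finset.range (B + 1), P ≠ 0 → e P = 0 := by
  induction B with
  | zero => intro P hP hP0; simp at hP; exact absurd hP hP0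
  | succ B ih =>
    have key : e (B + 1) = 0 := by
      -- Frequency $1$ jumps only at integers, outside the middle, so a single value at $\frac13$ is
      -- used instead of a jump.
      rcases Nat.eq_zero_or_pos B with rfl | hB
      · have hs : saw (1 / 3) = -(1 / 6) := by
          rw [saw_of_mem_Ioo (by norm_num) (by norm_num)]; norm_num
        have := h (1 / 3) ?_ ?_
        · simp only [zero_add, Finset.sum_range_succ, Finset.sum_range_zero] at this
          simp only [Nat.cast_zero, zero_mul, saw_zero, mul_zero, Nat.cast_one, one_mul, hs,
            zero_add] at this ⊢
          linarith
        · intro z hz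
          have h1 : (0 : ℝ) < z := by rw [← hz]; norm_num
          have h2 : (z : ℝ) < 1 := by rw [← hz]; norm_num
          have h1 : 0 < z := by exact_mod_cast h1
          have h2 : z < 1 := by exact_mod_cast h2
          omega
        · rw [hs, abs_neg, abs_of_pos (by norm_num)]; linarith
      · obtain ⟨a, hab, ha1, ha2⟩ := exists_coprime_mem_middle (b := B + 1) (by omega)
        have hbpos : (0 : ℝ) < ((B + 1 : ℕ) : ℝ) := by positivity
        set x : ℝ := (a : ℝ) / ((B + 1 : ℕ) : ℝ) with hx
        have hx1 : 1 / 6 ≤ x := by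
          rw [hx, div_le_div_iff₀ (by norm_num) hbpos, one_mul]; exact_mod_cast by omega
        have hx2 : x ≤ 5 / 6 := by
          rw [hx, div_le_div_iff₀ hbpos (by norm_num)]; exact_mod_cast by omega
        have hmid : ∀ᶠ y : ℝ in 𝓝 x, (∀ z : ℤ, y ≠ z) ∧ |saw y| < 1 / 3 + ε := by
          have hm : x ∈ Set.Ioo (max 0 (1 / 6 - ε)) (min 1 (5 / 6 + ε)) := by
            constructor
            · exact max_lt (by linarith) (by linarith)
            · exact lt_min (by linarith) (by linarith)
          filter_upwards [isOpen_Ioo.mem_nhds hm] with y hy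
          have h0 : 0 < y := lt_of_le_of_lt (le_max_left _ _) hy.1
          have h0' : 1 / 6 - ε < y := lt_of_le_of_lt (le_max_right _ _) hy.1
          have h1 : y < 1 := lt_of_lt_of_le hy.2 (min_le_left _ _)
          have h1' : y < 5 / 6 + ε := lt_of_lt_of_le hy.2 (min_le_right _ _)
          refine ⟨fun z hz => ?_, ?_⟩
          · rw [hz] at h0 h1
            have h0 : 0 < z := by exact_mod_cast h0
            have h1 : z < 1 := by exact_mod_cast h1
            omega
          · rw [saw_of_mem_Ioo h0 h1, abs_lt]
            constructor <;> linarith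
        have hp := nhdsWithin_le_nhds (s := Set.Ioi 0)
          ((tendsto_add_mul_nhds x 1).eventually hmid)
        have hn := nhdsWithin_le_nhds (s := Set.Ioi 0)
          ((tendsto_add_mul_nhds x (-1)).eventually hmid)
        have hjump : ∀ P ∈ Finset.range (B + 1 + 1), ∀ᶠ t in 𝓝[>] (0 : ℝ),
            e P * saw (P * (x + 1 * t)) - e P * saw (P * (x + -1 * t))
              = e P * (2 * P * t) - (if P = B + 1 then e P else 0) := by
          intro P hP
          rcases Nat.eq_zero_or_pos P with rfl | hP0
          · refine Eventually.of_forall fun t => ?_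
            simp
          · have hP' : (0 : ℝ) < P := by exact_mod_cast hP0
            filter_upwards [saw_add_sub_saw_sub_eventually (P * x) hP'] with t ht
            have e1 : (P : ℝ) * (x + 1 * t) = P * x + P * t := by ring
            have e2 : (P : ℝ) * (x + -1 * t) = P * x - P * t := by ring
            rw [e1, e2, ← mul_sub, ht]
            -- Since $x=a/(B+1)$ is in lowest terms, the top frequency alone jumps at $x$.
            have hiff : (∃ z : ℤ, (P : ℝ) * x = z) ↔ P = B + 1 := by
              constructor
              · rintro ⟨z, hz⟩
                rw [hx, ← mul_div_assoc, div_eq_iff hbpos.ne'] at hz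
                have hz' : ((P * a : ℕ) : ℤ) = z * ((B + 1 : ℕ) : ℤ) := by exact_mod_cast hz
                have hd : ((B + 1 : ℕ) : ℤ) ∣ ((P * a : ℕ) : ℤ) := ⟨z, by rw [hz']; ring⟩
                have hd : (B + 1) ∣ P * a := by exact_mod_cast hd
                have hd : (B + 1) ∣ P := hab.symm.dvd_of_dvd_mul_right hd
                have := Nat.le_of_dvd hP0 hd
                have := Finset.mem_range.1 hP
                omega
              · rintro rfl
                exact ⟨a, by rw [hx, mul_div_cancel₀ _ hbpos.ne']; simp⟩
            simp only [hiff]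
            split_ifs <;> ring
        have hall := (Finset.eventually_all _).2 hjump
        -- The sum vanishes at both $x+t$ and $x-t$; the difference leaves the jump against a linear
        -- term, which tends to $0$ with $t$.
        have hev : ∀ᶠ t in 𝓝[>] (0 : ℝ),
            e (B + 1) = (∑ P ∈ Finset.range (B + 1 + 1), e P * (2 * P)) * t := by
          filter_upwards [hall, hp, hn] with t ht htp htn
          have s1 := h _ htp.1 htp.2
          have s2 := h _ htn.1 htn.2
          have := Finset.sum_congr rfl ht
          rw [Finset.sum_sub_distrib, Finset.sum_sub_distrib, s1, s2] at this
          rw [Finset.sum_ite_eq' (Finset.range (B + 1 + 1)) (B + 1) e,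
            if_pos (by simp)] at this
          rw [Finset.sum_mul]
          have e3 : ∑ P ∈ Finset.range (B + 1 + 1), e P * (2 * (P : ℝ)) * t
            = ∑ P ∈ Finset.range (B + 1 + 1), e P * (2 * (P : ℝ) * t) :=
            Finset.sum_congr rfl fun P _ => by ring
          rw [e3]; linarith
        have hl : Tendsto (fun t : ℝ => (∑ P ∈ Finset.range (B + 1 + 1), e P * (2 * P)) * t)
            (𝓝[>] 0) (𝓝 0) := by
          have := (tendsto_add_mul_nhds 0 (∑ P ∈ Finset.range (B + 1 + 1), e P * (2 * P)))
          simp only [zero_add] at this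
          exact this.mono_left nhdsWithin_le_nhds
        exact tendsto_nhds_unique (tendsto_const_nhds.congr' hev) hl
    intro P hP hP0
    rcases eq_or_ne P (B + 1) with rfl | hne
    · exact key
    · refine ih (fun s hs hs' => ?_) P (Finset.mem_range.2 ?_) hP0
      · have := h s hs hs'
        rw [Finset.sum_range_succ, key, zero_mul, add_zero] at this
        exact this
      · have := Finset.mem_range.1 hP
        omega

/-- Version of `coeff_eq_zero_of_saw_sum_eq_zero` for integer frequencies. -/
theorem saw_sum_eq_zero_of_middle {ι : Type*} [Fintype ι] {ε : ℝ} (hε : 0 < ε)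
    (D : ι → ℝ) (P : ι → ℤ)
    (h : ∀ s : ℝ, (∀ z : ℤ, s ≠ z) → |saw s| < 1 / 3 + ε → ∑ j, D j * saw (P j * s) = 0)
    (s : ℝ) : ∑ j, D j * saw (P j * s) = 0 := by
  classical
  set B := Finset.univ.sup fun j => (P j).natAbs with hB
  set e : ℕ → ℝ := fun n => ∑ j with (P j).natAbs = n, D j * (P j).sign with he
  have hsaw : ∀ (j : ι) (s : ℝ), saw (P j * s) = (P j).sign * saw ((P j).natAbs * s) := by
    intro j s
    rcases lt_trichotomy (P j) 0 with hn | hz | hp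
    · rw [Int.sign_eq_neg_one_of_neg hn]
      have : (((P j).natAbs : ℕ) : ℝ) = -(P j : ℝ) := by
        rw [Nat.cast_natAbs, abs_of_neg hn]; push_cast; ring
      rw [this, neg_mul, saw_neg]; push_cast; ring
    · rw [hz]; simp [saw_zero]
    · rw [Int.sign_eq_one_of_pos hp]
      have : (((P j).natAbs : ℕ) : ℝ) = (P j : ℝ) := by
        rw [Nat.cast_natAbs, abs_of_pos hp]
      rw [this]; simp
  have hG : ∀ s : ℝ, ∑ j, D j * saw (P j * s)
      = ∑ n ∈ Finset.range (B + 1), e n * saw (n * s) := by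
    intro s
    rw [← Finset.sum_fiberwise_of_maps_to (s := Finset.univ) (t := Finset.range (B + 1))
      (g := fun j => (P j).natAbs)]
    · refine Finset.sum_congr rfl fun n _ => ?_
      rw [he, Finset.sum_mul]
      refine Finset.sum_congr rfl fun j hj => ?_
      rw [hsaw, (Finset.mem_filter.1 hj).2]; ring
    · intro j _
      exact Finset.mem_range.2 (Nat.lt_succ_of_le (Finset.le_sup (f := fun j => (P j).natAbs)
        (Finset.mem_univ j)))
  rw [hG]
  have := coeff_eq_zero_of_saw_sum_eq_zero hε B e fun s h1 h2 => by rw [← hG]; exact h s h1 h2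
  refine Finset.sum_eq_zero fun n hn => ?_
  rcases eq_or_ne n 0 with rfl | hn0
  · simp [saw_zero]
  · rw [this n hn hn0, zero_mul]

/-! ### Averages of the sawtooth over finite subgroups. -/

/-- The distribution relation of the sawtooth function. -/
theorem sum_saw_add_div (n : ℕ) (hn : 0 < n) (z : ℝ) :
    ∑ l ∈ Finset.range n, saw (z + l / n) = saw (n * z) := by
  have hn' : (0 : ℝ) < n := by exact_mod_cast hn
  -- Both sides are $1/n$-periodic in $z$, so $0\le z<1/n$ suffices; there no argument $z+l/n$ wraps
  -- around.
  have base : ∀ z : ℝ, 0 ≤ z → z * n < 1 →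
      ∑ l ∈ Finset.range n, saw (z + l / n) = saw (n * z) := by
    intro z hz0 hz1
    have hgauss : ∑ l ∈ Finset.range n, (l : ℝ) = n * (n - 1) / 2 := by
      have : ∀ m : ℕ, ∑ l ∈ Finset.range m, (l : ℝ) = m * (m - 1) / 2 := by
        intro m
        induction m with
        | zero => simp
        | succ m ih => rw [Finset.sum_range_succ, ih]; push_cast; ring
      exact this n
    have hlt : ∀ l ∈ Finset.range n, z + (l : ℝ) / n < 1 := by
      intro l hl
      have : (l : ℝ) + 1 ≤ n := by exact_mod_cast Finset.mem_range.1 hl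
      rw [← mul_lt_mul_iff_left₀ hn', add_mul, div_mul_cancel₀ _ hn'.ne']
      linarith
    rcases hz0.eq_or_lt with rfl | hzpos
    · rw [mul_zero, saw_zero]
      obtain ⟨m, rfl⟩ : ∃ m, n = m + 1 := ⟨n - 1, by omega⟩
      have h1 : ∀ l ∈ Finset.range m, saw (0 + ((l + 1 : ℕ) : ℝ) / ((m + 1 : ℕ) : ℝ))
          = ((l + 1 : ℕ) : ℝ) / ((m + 1 : ℕ) : ℝ) - 1 / 2 := by
        intro l hl
        have hl' := hlt (l + 1) (by have := Finset.mem_range.1 hl; simp; omega)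
        rw [saw_of_mem_Ioo (by positivity) hl', zero_add]
      rw [Finset.sum_range_succ', Finset.sum_congr rfl h1]
      rw [Finset.sum_range_succ'] at hgauss
      rw [Finset.sum_sub_distrib, ← Finset.sum_div]
      simp only [Nat.cast_zero, add_zero, zero_div, saw_zero] at hgauss ⊢
      rw [hgauss]
      simp only [Finset.sum_const, Finset.card_range, nsmul_eq_mul]
      field_simp
      push_cast
      ring
    · have h1 : ∀ l ∈ Finset.range n, saw (z + (l : ℝ) / n) = z + (l : ℝ) / n - 1 / 2 :=
        fun l hl => saw_of_mem_Ioo (by positivity) (hlt l hl)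
      rw [Finset.sum_congr rfl h1, Finset.sum_sub_distrib, Finset.sum_add_distrib,
        ← Finset.sum_div, hgauss, saw_of_mem_Ioo (by positivity) (by linarith)]
      simp only [Finset.sum_const, Finset.card_range, nsmul_eq_mul]
      field_simp
      ring
  have shift : ∀ z : ℝ, ∑ l ∈ Finset.range n, saw (z + 1 / n + l / n)
      = ∑ l ∈ Finset.range n, saw (z + l / n) := by
    intro z
    have e : ∀ l ∈ Finset.range n, saw (z + 1 / n + l / n) = saw (z + ((l + 1 : ℕ) : ℝ) / n) := by
      intro l _
      congr 1; push_cast; ring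
    rw [Finset.sum_congr rfl e]
    have h1 := Finset.sum_range_succ (fun l : ℕ => saw (z + (l : ℝ) / n)) n
    have h2 := Finset.sum_range_succ' (fun l : ℕ => saw (z + (l : ℝ) / n)) n
    have h3 : saw (z + (n : ℝ) / n) = saw (z + ((0 : ℕ) : ℝ) / n) := by
      rw [div_self hn'.ne']
      have := saw_add_int z 1
      push_cast at this
      rw [this]; simp
    linarith
  have shiftnat : ∀ (m : ℕ) (z : ℝ), ∑ l ∈ Finset.range n, saw (z + m / n + l / n)
      = ∑ l ∈ Finset.range n, saw (z + l / n) := by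
    intro m
    induction m with
    | zero => intro z; simp
    | succ m ih =>
      intro z
      rw [← ih z, ← shift (z + m / n)]
      refine Finset.sum_congr rfl fun l _ => ?_
      congr 1; push_cast; ring
  have shiftint : ∀ (m : ℤ) (z : ℝ), ∑ l ∈ Finset.range n, saw (z + m / n + l / n)
      = ∑ l ∈ Finset.range n, saw (z + l / n) := by
    intro m z
    obtain ⟨a, rfl | rfl⟩ := m.eq_nat_or_neg
    · simpa only [Int.cast_natCast] using shiftnat a z
    · rw [← shiftnat a (z + ((-(a : ℤ) : ℤ) : ℝ) / n)]
      refine Finset.sum_congr rfl fun l _ => ?_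
      congr 1; push_cast; ring
  have hz : z = Int.fract (n * z) / n + ⌊n * z⌋ / n := by
    rw [← add_div, Int.fract_add_floor, mul_div_cancel_left₀ _ hn'.ne']
  rw [hz, shiftint, base _ (div_nonneg (Int.fract_nonneg _) hn'.le)
    (by rw [div_mul_cancel₀ _ hn'.ne']; exact Int.fract_lt_one _), ← add_div,
    Int.fract_add_floor, mul_div_cancel₀ _ hn'.ne', mul_div_cancel₀ _ hn'.ne']
  conv_rhs => rw [← Int.fract_add_floor ((n : ℝ) * z), saw_add_int]

theorem sum_range_mul_of_periodic (f : ℕ → ℝ) (n g : ℕ) (hf : ∀ i, f (n + i) = f i) :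
    ∑ i ∈ Finset.range (g * n), f i = g * ∑ i ∈ Finset.range n, f i := by
  induction g with
  | zero => simp
  | succ g ih =>
    have : (g + 1) * n = n + g * n := by ring
    rw [this, Finset.sum_range_add, Finset.sum_congr rfl fun i _ => hf i, ih]
    push_cast; ring

theorem sum_range_mul_coprime (f : ℤ → ℝ) (n : ℕ) (hn : 0 < n) (hf : ∀ i l : ℤ, f (i + l * n) = f i)
    (β : ℤ) (hβ : IsCoprime β n) :
    ∑ i ∈ Finset.range n, f (i * β) = ∑ i ∈ Finset.range n, f i := by
  have hn' : (0 : ℤ) < n := by exact_mod_cast hn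
  have hmod : ∀ i : ℕ, ((((i : ℤ) * β % n).toNat : ℕ) : ℤ) = (i : ℤ) * β % n := fun i =>
    Int.toNat_of_nonneg (Int.emod_nonneg _ hn'.ne')
  have hmaps : ∀ i ∈ Finset.range n, ((i : ℤ) * β % n).toNat ∈ Finset.range n := by
    intro i _
    rw [Finset.mem_range]
    have := Int.emod_lt_of_pos ((i : ℤ) * β) hn'
    have := hmod i
    omega
  have hinj : Set.InjOn (fun i : ℕ => ((i : ℤ) * β % n).toNat) (Finset.range n) := by
    intro i hi j hj hij
    have h1 : (i : ℤ) * β % n = (j : ℤ) * β % n := by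
      rw [← hmod i, ← hmod j]; exact congrArg _ hij
    have h2 : (n : ℤ) ∣ ((j : ℤ) - i) * β := by
      rw [sub_mul]; exact Int.ModEq.dvd h1
    have h3 : (n : ℤ) ∣ (j : ℤ) - i := hβ.symm.dvd_of_dvd_mul_right h2
    have hi := Finset.mem_range.1 hi
    have hj := Finset.mem_range.1 hj
    have : (j : ℤ) - i = 0 := Int.eq_zero_of_abs_lt_dvd h3 (by rw [abs_lt]; omega)
    omega
  refine Finset.sum_nbij (fun i : ℕ => ((i : ℤ) * β % n).toNat) hmaps hinj
    (Finset.surjOn_of_injOn_of_card_le _ hmaps hinj le_rfl) fun i _ => ?_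
  rw [hmod i, ← hf ((i : ℤ) * β % n) ((i : ℤ) * β / n)]
  congr 1
  rw [mul_comm _ (n : ℤ), Int.emod_add_mul_ediv]

/-- With $g=\gcd(\beta,Q)$, the points $i\beta/Q$ run $g$ times through the multiples of $g/Q$
modulo $1$, and the distribution relation applies to each run. -/
theorem sum_saw_add_mul_div (Q : ℕ) (hQ : 0 < Q) (β : ℤ) (z : ℝ) :
    ∑ i ∈ Finset.range Q, saw (z + (i * β : ℤ) / Q)
      = (Int.gcd β Q : ℝ) * saw ((Q / Int.gcd β Q : ℕ) * z) := by
  set g := Int.gcd β Q with hg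
  have hgpos : 0 < g := Int.gcd_pos_of_ne_zero_right _ (by exact_mod_cast hQ.ne')
  obtain ⟨n, hn⟩ : g ∣ Q := by exact_mod_cast (Int.gcd_dvd_right β Q)
  obtain ⟨γ, hγ⟩ : (g : ℤ) ∣ β := Int.gcd_dvd_left β Q
  have hnpos : 0 < n := Nat.pos_of_ne_zero (by rintro rfl; simp at hn; omega)
  have hcop : IsCoprime γ n := by
    rw [Int.isCoprime_iff_gcd_eq_one]
    have : g = g * Int.gcd γ n := by
      conv_lhs => rw [hg, hγ, hn]
      push_cast
      rw [Int.gcd_mul_left]; simp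
    exact (Nat.eq_of_mul_eq_mul_left hgpos (by rw [mul_one]; exact this)).symm
  have hdiv : Q / g = n := by rw [hn]; exact Nat.mul_div_cancel_left n hgpos
  have hgR : (g : ℝ) ≠ 0 := by exact_mod_cast hgpos.ne'
  have hnR : (n : ℝ) ≠ 0 := by exact_mod_cast hnpos.ne'
  rw [hdiv, ← sum_saw_add_div n hnpos]
  have hper : ∀ i l : ℤ, saw (z + ((i + l * n : ℤ) : ℝ) / n) = saw (z + (i : ℝ) / n) := by
    intro i l
    rw [← saw_add_int (z + (i : ℝ) / n) l]
    congr 1; push_cast; field_simp; ring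
  have h1 := sum_range_mul_coprime (fun i : ℤ => saw (z + (i : ℝ) / n)) n hnpos hper γ hcop
  have h2 := sum_range_mul_of_periodic (fun i : ℕ => saw (z + ((i * γ : ℤ) : ℝ) / n)) n g (by
    intro i
    rw [← hper (i * γ) γ]
    congr 2; push_cast; ring)
  simp only [Int.cast_natCast] at h1
  rw [← h1, ← h2, hn]
  refine Finset.sum_congr rfl fun i _ => ?_
  congr 1
  rw [hγ]; push_cast; field_simp

/-- Summing over $i$ multiplies the slope $u$ by $Q/\gcd(\beta,Q)$, which by `hu` makes it an
integer; summing over $m$ then absorbs the remaining shift. A double average thus depends on $s$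
through one integer frequency. -/
theorem exists_sum_sum_saw (Q : ℕ) (hQ : 0 < Q) (α β : ℤ) (u : ℝ) (hu : Q * u = β) :
    ∃ (D : ℝ) (P : ℤ), ∀ s : ℝ,
      ∑ m ∈ Finset.range Q, ∑ i ∈ Finset.range Q,
        saw (u * s + (m * α : ℤ) / Q + (i * β : ℤ) / Q) = D * saw (P * s) := by
  set g := Int.gcd β Q with hg
  have hgpos : 0 < g := Int.gcd_pos_of_ne_zero_right _ (by exact_mod_cast hQ.ne')
  obtain ⟨n, hn⟩ : g ∣ Q := by exact_mod_cast (Int.gcd_dvd_right β Q)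
  obtain ⟨γ, hγ⟩ : (g : ℤ) ∣ β := Int.gcd_dvd_left β Q
  have hdiv : Q / g = n := by rw [hn]; exact Nat.mul_div_cancel_left n hgpos
  have hgR : (g : ℝ) ≠ 0 := by exact_mod_cast hgpos.ne'
  have hnu : (n : ℝ) * u = γ := by
    have h1 : (g : ℝ) * (n * u) = g * γ := by
      rw [← mul_assoc]
      have : ((g * n : ℕ) : ℝ) = Q := by exact_mod_cast hn.symm
      push_cast at this
      rw [this, hu, hγ]; push_cast; ring
    exact mul_left_cancel₀ hgR h1
  refine ⟨g * Int.gcd (n * α) Q, (Q / Int.gcd (n * α) Q : ℕ) * γ, fun s => ?_⟩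
  have e1 : ∀ m ∈ Finset.range Q, ∑ i ∈ Finset.range Q,
      saw (u * s + (m * α : ℤ) / Q + (i * β : ℤ) / Q)
        = g * saw (γ * s + (m * (n * α) : ℤ) / Q) := by
    intro m _
    rw [sum_saw_add_mul_div Q hQ β, ← hg, hdiv]
    congr 2
    rw [← hnu]; push_cast; ring
  rw [Finset.sum_congr rfl e1, ← Finset.mul_sum, sum_saw_add_mul_div Q hQ]
  rw [mul_assoc, Int.cast_mul, Int.cast_natCast, mul_assoc _ (γ : ℝ)]

/-! ### A generic integral direction orthogonal to the relations. -/

/-- Integral vectors orthogonal to a subgroup of `ι → ℤ`, as generic as the subgroup permits. -/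
theorem exists_orthogonal_generic {ι : Type*} [Fintype ι] [DecidableEq ι]
    (Λ : Submodule ℤ (ι → ℤ)) (o : ι) (ho : ∀ N : ℕ, 0 < N → Pi.single o (N : ℤ) ∉ Λ) :
    ∃ w : ι → ℤ, (∀ m ∈ Λ, ∑ j, m j * w j = 0) ∧ 0 < w o ∧
      ∀ j, w j ≠ 0 ∨ ∃ N : ℕ, 0 < N ∧ Pi.single j (N : ℤ) ∈ Λ := by
  -- The rational span of $\Lambda$. A functional on the quotient that is nonzero on every surviving
  -- basis vector, with denominators cleared, yields `w`.
  let S : Submodule ℚ (ι → ℚ) :=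
    { carrier := {x | ∃ N : ℕ, 0 < N ∧ ∃ m ∈ Λ, ∀ j, (N : ℚ) * x j = m j}
      zero_mem' := ⟨1, one_pos, 0, Λ.zero_mem, by simp⟩
      add_mem' := by
        rintro x y ⟨N, hN, m, hm, hx⟩ ⟨N', hN', m', hm', hy⟩
        refine ⟨N * N', by positivity, (N' : ℤ) • m + (N : ℤ) • m',
          Λ.add_mem (Λ.smul_mem _ hm) (Λ.smul_mem _ hm'), fun j => ?_⟩
        simp only [Pi.add_apply, Pi.smul_apply, smul_eq_mul]
        push_cast
        rw [← hx, ← hy]; ring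
      smul_mem' := by
        rintro q x ⟨N, hN, m, hm, hx⟩
        refine ⟨q.den * N, Nat.mul_pos q.den_pos hN, q.num • m, Λ.smul_mem _ hm, fun j => ?_⟩
        simp only [Pi.smul_apply, smul_eq_mul]
        push_cast
        rw [← hx]
        have := Rat.mul_den_eq_num q
        rw [← this]; ring }
  have hS : ∀ j, Pi.single j (1 : ℚ) ∈ S → ∃ N : ℕ, 0 < N ∧ Pi.single j (N : ℤ) ∈ Λ := by
    rintro j ⟨N, hN, m, hm, hx⟩
    refine ⟨N, hN, ?_⟩
    convert hm using 1
    ext l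
    have := hx l
    rcases eq_or_ne l j with rfl | hl
    · simp at this ⊢; exact_mod_cast this
    · simp [hl] at this ⊢; exact_mod_cast this
  let J := {j : ι // Pi.single j (1 : ℚ) ∉ S}
  obtain ⟨f, hf⟩ := Module.exists_dual_forall_apply_ne_zero (K := ℚ) (M := (ι → ℚ) ⧸ S)
    (fun j : J => S.mkQ (Pi.single j.1 (1 : ℚ))) (fun j h => j.2 (by simpa using h))
  let c : ι → ℚ := fun j => f (S.mkQ (Pi.single j (1 : ℚ)))
  have hc : ∀ x : ι → ℚ, f (S.mkQ x) = ∑ j, x j * c j := by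
    intro x
    have : x = ∑ j, x j • (Pi.single j (1 : ℚ) : ι → ℚ) := by
      ext l; simp [Finset.sum_apply, Pi.single_apply]
    conv_lhs => rw [this]
    rw [map_sum, map_sum]
    refine Finset.sum_congr rfl fun j _ => ?_
    rw [map_smul, map_smul, smul_eq_mul]
  let d : ℤ := ∏ j, ((c j).den : ℤ)
  have hd : (d : ℚ) ≠ 0 := by
    simp only [d]; push_cast
    exact Finset.prod_ne_zero_iff.2 fun j _ => by exact_mod_cast (c j).den_ne_zero
  have hint : ∀ j, ∃ z : ℤ, (z : ℚ) = d * c j := by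
    intro j
    obtain ⟨t, ht⟩ : ((c j).den : ℤ) ∣ d := Finset.dvd_prod_of_mem _ (Finset.mem_univ j)
    refine ⟨t * (c j).num, ?_⟩
    rw [ht]; push_cast
    rw [← Rat.mul_den_eq_num (c j)]; ring
  choose w hw using hint
  have horth : ∀ m ∈ Λ, ∑ j, m j * w j = 0 := by
    intro m hm
    have h0 : f (S.mkQ fun j => (m j : ℚ)) = 0 := by
      have : S.mkQ (fun j => (m j : ℚ)) = 0 := by
        rw [Submodule.mkQ_apply, Submodule.Quotient.mk_eq_zero]
        exact ⟨1, one_pos, m, hm, by simp⟩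
      rw [this, map_zero]
    rw [hc] at h0
    have : ((∑ j, m j * w j : ℤ) : ℚ) = 0 := by
      push_cast
      rw [← mul_zero (d : ℚ), ← h0, Finset.mul_sum]
      refine Finset.sum_congr rfl fun j _ => ?_
      rw [hw]; ring
    exact_mod_cast this
  have hne : ∀ j, w j ≠ 0 ∨ ∃ N : ℕ, 0 < N ∧ Pi.single j (N : ℤ) ∈ Λ := by
    intro j
    by_cases hj : Pi.single j (1 : ℚ) ∈ S
    · exact Or.inr (hS j hj)
    · left
      intro h0
      have h1 := hw j
      rw [h0, Int.cast_zero] at h1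
      exact hf ⟨j, hj⟩ ((mul_eq_zero.1 h1.symm).resolve_left hd)
  have hwo : w o ≠ 0 := by
    rcases hne o with h | ⟨N, hN, h⟩
    · exact h
    · exact absurd h (ho N hN)
  rcases lt_or_gt_of_ne hwo with h | h
  · refine ⟨-w, fun m hm => ?_, by simpa using h, fun j => ?_⟩
    · simpa [Finset.sum_neg_distrib] using horth m hm
    · simpa using hne j
  · exact ⟨w, horth, h, hne⟩

/-! ### Kronecker-type approximation by powers of cosines. -/

theorem cexp_two_pi_I_eq_one_iff (x : ℝ) :
    Complex.exp (2 * Real.pi * Complex.I * x) = 1 ↔ ∃ z : ℤ, x = z := by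
  rw [Complex.exp_eq_one_iff]
  have hpi : (2 * Real.pi * Complex.I : ℂ) ≠ 0 := Complex.two_pi_I_ne_zero
  constructor
  · rintro ⟨z, hz⟩
    refine ⟨z, ?_⟩
    rw [mul_comm (z : ℂ)] at hz
    exact_mod_cast mul_left_cancel₀ hpi hz
  · rintro ⟨z, rfl⟩
    exact ⟨z, by push_cast; ring⟩

theorem sum_cexp_mul_div (r : ℕ) (hr : 0 < r) (M : ℤ) :
    ∑ k ∈ Finset.range r, Complex.exp (2 * Real.pi * Complex.I * ((k * (M / r) : ℝ) : ℂ))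
      = if (r : ℤ) ∣ M then (r : ℂ) else 0 := by
  have hr' : (r : ℝ) ≠ 0 := by exact_mod_cast hr.ne'
  set ζ := Complex.exp (2 * Real.pi * Complex.I * ((M / r : ℝ) : ℂ)) with hζ
  have hpow : ∀ k : ℕ, Complex.exp (2 * Real.pi * Complex.I * ((k * (M / r) : ℝ) : ℂ)) = ζ ^ k := by
    intro k
    rw [hζ, ← Complex.exp_nat_mul]
    congr 1; push_cast; ring
  simp only [hpow]
  have hiff : ζ = 1 ↔ (r : ℤ) ∣ M := by
    rw [hζ, cexp_two_pi_I_eq_one_iff]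
    constructor
    · rintro ⟨z, hz⟩
      rw [div_eq_iff hr'] at hz
      exact ⟨z, by rw [mul_comm]; exact_mod_cast hz⟩
    · rintro ⟨z, rfl⟩
      exact ⟨z, by push_cast; field_simp⟩
  split_ifs with h
  · simp [hiff.2 h]
  · have h1 : ζ ≠ 1 := fun h1 => h (hiff.1 h1)
    have h2 : ζ ^ r = 1 := by
      rw [← hpow, cexp_two_pi_I_eq_one_iff]
      exact ⟨M, by field_simp⟩
    rw [geom_sum_eq h1, h2]; simp

theorem cos_pi_mul_pow (K : ℕ) (u : ℝ) :
    ((Real.cos (Real.pi * u) ^ (2 * K) : ℝ) : ℂ) = ∑ l ∈ Finset.range (2 * K + 1),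
      (((2 * K).choose l / 4 ^ K : ℝ) : ℂ)
        * Complex.exp (2 * Real.pi * Complex.I * ((((l : ℤ) - K : ℤ) * u : ℝ) : ℂ)) := by
  have h1 : Complex.cos (Real.pi * u) = Complex.exp (-(Real.pi * Complex.I * u))
      * (Complex.exp (2 * Real.pi * Complex.I * u) + 1) / 2 := by
    rw [Complex.cos, mul_add, ← Complex.exp_add, mul_one]
    congr 3 <;> ring
  push_cast
  rw [h1, div_pow, mul_pow, add_pow, ← Complex.exp_nat_mul, Finset.mul_sum, Finset.sum_div]
  refine Finset.sum_congr rfl fun l _ => ?_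
  rw [one_pow, mul_one, ← Complex.exp_nat_mul, ← mul_assoc, ← Complex.exp_add, pow_mul]
  have : ((2 * K : ℕ) : ℂ) * -(Real.pi * Complex.I * u) + (l : ℂ) * (2 * Real.pi * Complex.I * u)
      = 2 * Real.pi * Complex.I * ((l - K) * u) := by push_cast; ring
  rw [this]; norm_num; ring

/-- In the Fourier expansion all coefficients are nonnegative, and summing over $k$ keeps only
frequencies that are relations modulo $r$. By `hh` their phases at $h$ are trivial, so every
surviving term is nonnegative and the zero frequency alone gives the bound. -/
theorem le_sum_prod_cos_pow {ι : Type*} [Fintype ι] [DecidableEq ι] (r : ℕ) (hr : 0 < r)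
    (c : ι → ℤ) (h : ι → ℝ) (K : ℕ)
    (hh : ∀ p ∈ Fintype.piFinset fun _ : ι => Finset.range (2 * K + 1),
      (r : ℤ) ∣ ∑ j, ((p j : ℤ) - K) * c j → ∃ z : ℤ, ∑ j, (((p j : ℤ) - K : ℤ) : ℝ) * h j = z) :
    (K.centralBinom / 4 ^ K : ℝ) ^ Fintype.card ι * r ≤
      ∑ k ∈ Finset.range r, ∏ j, Real.cos (Real.pi * (k * (c j / r) - h j)) ^ (2 * K) := by
  set coef : (ι → ℕ) → ℝ := fun p => ∏ j, ((2 * K).choose (p j) / 4 ^ K : ℝ) with hcoef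
  have hcoef0 : ∀ p, 0 ≤ coef p := fun p => Finset.prod_nonneg fun j _ => by positivity
  have key : ∑ k ∈ Finset.range r, ∏ j, Real.cos (Real.pi * (k * (c j / r) - h j)) ^ (2 * K)
      = ∑ p ∈ Fintype.piFinset fun _ : ι => Finset.range (2 * K + 1),
        coef p * (if (r : ℤ) ∣ ∑ j, ((p j : ℤ) - K) * c j then (r : ℝ) else 0) := by
    apply Complex.ofReal_injective
    rw [Complex.ofReal_sum, Complex.ofReal_sum]
    simp only [Complex.ofReal_prod, cos_pi_mul_pow]
    simp only [Finset.prod_univ_sum]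
    rw [Finset.sum_comm]
    refine Finset.sum_congr rfl fun p hp => ?_
    set M : ℤ := ∑ j, ((p j : ℤ) - K) * c j with hM
    set y : ℝ := ∑ j, (((p j : ℤ) - K : ℤ) : ℝ) * h j with hy
    have hterm : ∀ k ∈ Finset.range r, ∏ j, ((((2 * K).choose (p j) / 4 ^ K : ℝ) : ℂ)
        * Complex.exp (2 * Real.pi * Complex.I *
          (((((p j : ℕ) : ℤ) - K : ℤ) * ((k : ℝ) * (c j / r) - h j) : ℝ) : ℂ)))
        = coef p * Complex.exp (2 * Real.pi * Complex.I * ((-y : ℝ) : ℂ))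
          * Complex.exp (2 * Real.pi * Complex.I * ((k * (M / r) : ℝ) : ℂ)) := by
      intro k _
      rw [Finset.prod_mul_distrib, ← Complex.exp_sum, mul_assoc (coef p : ℂ), ← Complex.exp_add,
        hcoef, Complex.ofReal_prod]
      congr 2
      rw [← Finset.mul_sum, ← mul_add, ← Complex.ofReal_sum, ← Complex.ofReal_add]
      congr 2
      rw [hy, hM, Int.cast_sum, Finset.sum_div, Finset.mul_sum, ← Finset.sum_neg_distrib,
        ← Finset.sum_add_distrib]
      refine Finset.sum_congr rfl fun j _ => ?_
      push_cast; ring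
    rw [Finset.sum_congr rfl hterm, ← Finset.mul_sum, sum_cexp_mul_div r hr]
    split_ifs with hd
    · obtain ⟨z, hz⟩ := hh p hp hd
      have : Complex.exp (2 * Real.pi * Complex.I * ((-y : ℝ) : ℂ)) = 1 :=
        (cexp_two_pi_I_eq_one_iff _).2 ⟨-z, by rw [hy, hz]; push_cast; rfl⟩
      rw [this]; push_cast; ring
    · simp
  rw [key]
  have hmem : (fun _ : ι => K) ∈ Fintype.piFinset fun _ : ι => Finset.range (2 * K + 1) := by
    simp only [Fintype.mem_piFinset, Finset.mem_range]; intro; omega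
  refine le_trans (le_of_eq ?_) (Finset.single_le_sum (fun p _ => mul_nonneg (hcoef0 p)
    (by split_ifs <;> positivity)) hmem)
  simp [hcoef, Nat.centralBinom_eq_two_mul_choose, div_pow]

theorem cos_pi_mul_sq_le {η u : ℝ} (hη0 : 0 < η) (hu : ∀ z : ℤ, η ≤ |u - z|) :
    Real.cos (Real.pi * u) ^ 2 ≤ Real.cos (Real.pi * η) ^ 2 := by
  set f := u - round u with hf
  have h1 : |f| ≤ 1 / 2 := abs_sub_round u
  have h2 : η ≤ |f| := hu (round u)
  have e : Real.cos (Real.pi * u) ^ 2 = Real.cos (Real.pi * |f|) ^ 2 := by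
    have : Real.pi * u = Real.pi * f + (round u : ℤ) * Real.pi := by rw [hf]; ring
    rw [this, Real.cos_add_int_mul_pi, mul_pow]
    have hs : (((-1 : ℝ) ^ (round u)) ^ 2) = 1 := by
      rw [← zpow_natCast, ← zpow_mul, mul_comm, zpow_mul]; norm_num
    rw [hs, one_mul]
    rcases abs_cases f with ⟨h, _⟩ | ⟨h, _⟩
    · rw [h]
    · rw [h, mul_neg, Real.cos_neg]
  have hpi := Real.pi_pos
  rw [e]
  refine pow_le_pow_left₀ (Real.cos_nonneg_of_mem_Icc ⟨?_, ?_⟩) ?_ 2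
  · nlinarith [abs_nonneg f]
  · nlinarith
  · exact Real.cos_le_cos_of_nonneg_of_le_pi (by positivity) (by nlinarith)
      (mul_le_mul_of_nonneg_left h2 hpi.le)

/-- The normalised central binomial coefficient is at least $1/(2K)$, so its powers decay only
polynomially, against exponential decay of $\rho^K$. -/
theorem exists_centralBinom_gt (d : ℕ) {ρ : ℝ} (h0 : 0 ≤ ρ) (h1 : ρ < 1) :
    ∃ K : ℕ, ρ ^ K < (K.centralBinom / 4 ^ K : ℝ) ^ d := by
  have ht := (tendsto_pow_const_mul_const_pow_of_lt_one d h0 h1).const_mul ((2 : ℝ) ^ d)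
  rw [mul_zero] at ht
  obtain ⟨K, hK, hK1⟩ := ((ht.eventually (gt_mem_nhds (zero_lt_one' ℝ))).and
    (eventually_ge_atTop 1)).exists
  refine ⟨K, ?_⟩
  have hKpos : (0 : ℝ) < K := by exact_mod_cast hK1
  have hc : (1 / (2 * K) : ℝ) ≤ K.centralBinom / 4 ^ K := by
    rw [div_le_div_iff₀ (by positivity) (by positivity)]
    have := Nat.four_pow_le_two_mul_self_mul_centralBinom K hK1
    have : (4 : ℝ) ^ K ≤ 2 * K * K.centralBinom := by exact_mod_cast this
    linarith
  refine lt_of_lt_of_le ?_ (pow_le_pow_left₀ (by positivity) hc d)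
  rw [div_pow, one_pow, lt_div_iff₀ (by positivity), mul_pow]
  linarith

/-- Multiples of `c n / r n` approximate every point of the torus which satisfies the relations
satisfied by almost all `c n / r n`. -/
theorem eventually_exists_approx {ι : Type*} [Fintype ι] [DecidableEq ι] (U : Ultrafilter ℕ)
    (r : ℕ → ℕ) (hr : ∀ n, 0 < r n) (c : ℕ → ι → ℤ) (h : ι → ℝ)
    (hh : ∀ m : ι → ℤ, (∀ᶠ n in U, (r n : ℤ) ∣ ∑ j, m j * c n j) →
      ∃ z : ℤ, ∑ j, (m j : ℝ) * h j = z) {η : ℝ} (hη : 0 < η) :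
    ∀ᶠ n in U, ∃ k : ℤ, ∀ j, ∃ z : ℤ, |k * (c n j / r n) - h j - z| < η := by
  wlog hη2 : η ≤ 1 / 4 generalizing η
  · filter_upwards [this (η := 1 / 4) (by norm_num) le_rfl] with n ⟨k, hk⟩
    refine ⟨k, fun j => ?_⟩
    obtain ⟨z, hz⟩ := hk j
    exact ⟨z, by linarith⟩
  have hpi := Real.pi_pos
  have hρ1 : Real.cos (Real.pi * η) ^ 2 < 1 := by
    have h1 : 0 < Real.sin (Real.pi * η) :=
      Real.sin_pos_of_pos_of_lt_pi (by positivity) (by nlinarith)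
    have h2 := Real.sin_sq_add_cos_sq (Real.pi * η)
    nlinarith
  obtain ⟨K, hK⟩ := exists_centralBinom_gt (Fintype.card ι) (sq_nonneg (Real.cos (Real.pi * η))) hρ1
  -- $K$ is fixed before $n$, so only finitely many frequencies matter. By the ultrafilter dichotomy
  -- each is a relation for almost all $n$ or for almost none.
  have hev : ∀ p ∈ Fintype.piFinset fun _ : ι => Finset.range (2 * K + 1), ∀ᶠ n in U,
      ((r n : ℤ) ∣ ∑ j, ((p j : ℤ) - K) * c n j →
        ∃ z : ℤ, ∑ j, (((p j : ℤ) - K : ℤ) : ℝ) * h j = z) := by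
    intro p _
    by_cases hp : ∀ᶠ n in U, (r n : ℤ) ∣ ∑ j, ((p j : ℤ) - K) * c n j
    · exact Eventually.of_forall fun n _ => hh _ hp
    · filter_upwards [Ultrafilter.eventually_not.2 hp] with n hn h'
      exact absurd h' hn
  filter_upwards [(Finset.eventually_all _).2 hev] with n hn
  by_contra hcon
  push Not at hcon
  have h1 := le_sum_prod_cos_pow (r n) (hr n) (c n) h K hn
  -- If no multiple is $\eta$-close to $h$, each product has a factor at most $\cos^2(\pi\eta)^K$,
  -- which contradicts the lower bound `h1`.
  have h2 : ∑ k ∈ Finset.range (r n), ∏ j, Real.cos (Real.pi * (k * (c n j / r n) - h j)) ^ (2 * K)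
      ≤ ∑ k ∈ Finset.range (r n), (Real.cos (Real.pi * η) ^ 2) ^ K := by
    refine Finset.sum_le_sum fun k _ => ?_
    obtain ⟨j, hj⟩ := hcon k
    have hj' := cos_pi_mul_sq_le hη hj
    rw [← Finset.mul_prod_erase _ _ (Finset.mem_univ j)]
    refine le_trans (mul_le_of_le_one_right ?_ (Finset.prod_le_one ?_ ?_)) ?_
    · rw [pow_mul]; positivity
    · intro i _; rw [pow_mul]; positivity
    · intro i _
      rw [pow_mul]
      exact pow_le_one₀ (sq_nonneg _) (Real.cos_sq_le_one _)
    · rw [pow_mul]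
      exact pow_le_pow_left₀ (sq_nonneg _) (by simpa using hj') K
  rw [Finset.sum_const, Finset.card_range, nsmul_eq_mul] at h2
  have hrpos : (0 : ℝ) < r n := by exact_mod_cast hr n
  nlinarith

/-! ### The limiting subgroup of the torus and its generic points. -/

theorem eventually_ne_int (x : ℝ) : ∀ᶠ y : ℝ in 𝓝[≠] x, ∀ z : ℤ, y ≠ z := by
  have hm : x ∈ Set.Ioo ((⌈x⌉ : ℝ) - 1) (⌊x⌋ + 1) :=
    ⟨by linarith [Int.ceil_lt_add_one x], Int.lt_floor_add_one x⟩
  filter_upwards [nhdsWithin_le_nhds (isOpen_Ioo.mem_nhds hm), self_mem_nhdsWithin] with y hy hne z hz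
  rw [hz] at hy
  have h1 : ⌈x⌉ - 1 < z := by exact_mod_cast hy.1
  have h2 : z < ⌊x⌋ + 1 := by exact_mod_cast hy.2
  refine hne ?_
  rw [Set.mem_singleton_iff, hz]
  exact le_antisymm (Int.le_floor.1 (by omega)) (Int.ceil_le.1 (by omega))

theorem eventually_add_mul_ne_int (x : ℝ) {c : ℝ} (hc : c ≠ 0) :
    ∀ᶠ t in 𝓝[>] (0 : ℝ), ∀ z : ℤ, x + c * t ≠ z := by
  have ht : Tendsto (fun t : ℝ => x + c * t) (𝓝[>] 0) (𝓝[≠] x) := by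
    refine tendsto_nhdsWithin_iff.2 ⟨(tendsto_add_mul_nhds x c).mono_left nhdsWithin_le_nhds, ?_⟩
    filter_upwards [self_mem_nhdsWithin] with t ht
    have : t ≠ 0 := (Set.mem_Ioi.1 ht).ne'
    simp [hc, this]
  exact ht.eventually (eventually_ne_int x)

section Relations

variable {ι : Type*} [Fintype ι] (U : Ultrafilter ℕ) (r : ℕ → ℕ) (c : ℕ → ι → ℤ)

/-- The linear relations modulo `r n` satisfied by `c n` for almost all `n`. -/
def relations : Submodule ℤ (ι → ℤ) where
  carrier := {m | ∀ᶠ n in U, (r n : ℤ) ∣ ∑ j, m j * c n j}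
  zero_mem' := by simp
  add_mem' := by
    intro a b ha hb
    filter_upwards [ha, hb] with n h1 h2
    simpa [add_mul, Finset.sum_add_distrib] using dvd_add h1 h2
  smul_mem' := by
    intro z a ha
    filter_upwards [ha] with n h1
    simpa [mul_assoc, ← Finset.mul_sum] using Dvd.dvd.mul_left h1 z

theorem mem_relations {m : ι → ℤ} :
    m ∈ relations U r c ↔ ∀ᶠ n in U, (r n : ℤ) ∣ ∑ j, m j * c n j := Iff.rfl

/-- The points of the torus satisfying all the relations. -/
def Admissible (h : ι → ℝ) : Prop :=
  ∀ m ∈ relations U r c, ∃ z : ℤ, ∑ j, (m j : ℝ) * h j = z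

/-- Each coordinate is either nonintegral or a torsion character. -/
def Generic [DecidableEq ι] (h : ι → ℝ) : Prop :=
  ∀ j, (∀ z : ℤ, h j ≠ z) ∨ ∃ N : ℕ, 0 < N ∧ Pi.single j (N : ℤ) ∈ relations U r c

/-- The relation module is Noetherian, so infinitely many conditions reduce to finitely many
generators and hold at a single $n$. -/
theorem eventually_forall_relations :
    ∀ᶠ n in U, ∀ m ∈ relations U r c, (r n : ℤ) ∣ ∑ j, m j * c n j := by
  obtain ⟨S, hS⟩ := (inferInstance : IsNoetherian ℤ (ι → ℤ)).noetherian (relations U r c)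
  have h1 : ∀ m ∈ S, ∀ᶠ n in U, (r n : ℤ) ∣ ∑ j, m j * c n j := fun m hm =>
    (mem_relations U r c).1 (hS ▸ Submodule.subset_span hm)
  filter_upwards [(Finset.eventually_all S).2 h1] with n hn m hm
  rw [← hS] at hm
  induction hm using Submodule.span_induction with
  | mem x hx => exact hn x hx
  | zero => simp
  | add x y _ _ hx hy => simpa [add_mul, Finset.sum_add_distrib] using dvd_add hx hy
  | smul z x _ hx => simpa [mul_assoc, ← Finset.mul_sum] using Dvd.dvd.mul_left hx z

variable {U r c}

/-- Genericity removes the trouble with jumps: at a nonintegral coordinate `saw` is continuous,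
while a torsion coordinate takes values in $\frac1N\mathbb Z$, where a sufficiently close
approximation is an equality modulo $1$. -/
theorem exists_saw_approx [DecidableEq ι] (hr : ∀ n, 0 < r n) {h : ι → ℝ} (ha : Admissible U r c h)
    (hg : Generic U r c h) {δ : ℝ} (hδ : 0 < δ) :
    ∃ (n : ℕ) (k : ℤ), ∀ j, |saw (k * (c n j / r n)) - saw (h j)| < δ := by
  have hloc : ∀ j, ∃ η₀ > 0, ∀ᶠ n in U, ∀ k z : ℤ, |k * (c n j / r n) - h j - z| < η₀ →
      |saw (k * (c n j / r n)) - saw (h j)| < δ := by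
    intro j
    have hper : ∀ (x : ℝ) (z : ℤ), saw x = saw (x - z) := fun x z => by
      rw [← saw_add_int (x - z) z, sub_add_cancel]
    rcases hg j with hj | ⟨N, hN, hNr⟩
    · obtain ⟨η, hη, hball⟩ := Metric.eventually_nhds_iff.1 (saw_eventually_eq hj)
      refine ⟨min η δ, lt_min hη hδ, Eventually.of_forall fun n k z hz => ?_⟩
      have e : (k : ℝ) * (c n j / r n) - z - h j = k * (c n j / r n) - h j - z := by ring
      have h1 := hball (y := k * (c n j / r n) - z)
        (by rw [Real.dist_eq, e]; exact lt_of_lt_of_le hz (min_le_left _ _))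
      rw [hper _ z, h1, add_sub_cancel_left, e]
      exact lt_of_lt_of_le hz (min_le_right _ _)
    · have hN' : (0 : ℝ) < N := by exact_mod_cast hN
      refine ⟨1 / N, by positivity, ?_⟩
      obtain ⟨z₀, hz₀⟩ := ha _ hNr
      have hz₀ : (N : ℝ) * h j = z₀ := by
        rw [← hz₀, Finset.sum_eq_single j]
        · simp
        · intro i _ hi; simp [hi]
        · simp
      filter_upwards [(mem_relations U r c).1 hNr] with n hn k z hz
      have hn : (r n : ℤ) ∣ N * c n j := by
        rw [Finset.sum_eq_single j] at hn
        · simpa using hn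
        · intro i _ hi; simp [hi]
        · simp
      obtain ⟨l, hl⟩ := hn
      have hl : (N : ℝ) * c n j = r n * l := by exact_mod_cast hl
      have hrn : (r n : ℝ) ≠ 0 := by exact_mod_cast (hr n).ne'
      have e : (N : ℝ) * (k * (c n j / r n) - h j - z) = ((k * l - z₀ - N * z : ℤ) : ℝ) := by
        push_cast
        rw [← hz₀]
        have : (N : ℝ) * (c n j / r n) = l := by
          rw [← mul_div_assoc, hl, mul_div_cancel_left₀ _ hrn]
        rw [← this]; ring
      have h1 : |((k * l - z₀ - N * z : ℤ) : ℝ)| < 1 := by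
        rw [← e, abs_mul, abs_of_pos hN']
        calc (N : ℝ) * _ < N * (1 / N) := mul_lt_mul_of_pos_left hz hN'
          _ = 1 := by field_simp
      have h2 : k * l - z₀ - N * z = 0 := Int.abs_lt_one_iff.1 (by exact_mod_cast h1)
      rw [h2, Int.cast_zero] at e
      have h3 := (mul_eq_zero.1 e).resolve_left hN'.ne'
      have h4 : (k : ℝ) * (c n j / r n) - z = h j := by linarith
      rw [hper _ z, h4, sub_self, abs_zero]
      exact hδ
  choose η₀ hη₀ hη using hloc
  have hsmall : ∀ᶠ η in 𝓝[>] (0 : ℝ), ∀ j, η < η₀ j :=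
    eventually_all.2 fun j => nhdsWithin_le_nhds (isOpen_Iio.mem_nhds (hη₀ j))
  obtain ⟨η, hη1, hη2⟩ := (hsmall.and self_mem_nhdsWithin).exists
  obtain ⟨n, hn1, k, hn2⟩ :=
    ((eventually_all.2 hη).and (eventually_exists_approx U r hr c h ha hη2)).exists
  refine ⟨n, k, fun j => ?_⟩
  obtain ⟨z, hz⟩ := hn2 j
  exact hn1 j k z (hz.trans (hη1 j))

theorem abs_saw_sum_sub_le {x y : ι → ℝ} {δ : ℝ} (h : ∀ j, |saw (x j) - saw (y j)| < δ) :
    |∑ j, saw (x j) - ∑ j, saw (y j)| ≤ Fintype.card ι * δ := by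
  rw [← Finset.sum_sub_distrib]
  refine (Finset.abs_sum_le_sum_abs _ _).trans ?_
  calc _ ≤ ∑ _j : ι, δ := Finset.sum_le_sum fun j _ => (h j).le
    _ = _ := by simp

theorem le_zero_of_forall_le_mul {x d ε : ℝ} (hε : 0 < ε)
    (h : ∀ δ, 0 < δ → δ < ε → x ≤ d * δ) : x ≤ 0 := by
  have ht : Tendsto (fun δ : ℝ => d * δ) (𝓝[>] 0) (𝓝 0) := by
    have := tendsto_add_mul_nhds 0 d
    simp only [zero_add] at this
    exact this.mono_left nhdsWithin_le_nhds
  refine ge_of_tendsto ht ?_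
  filter_upwards [self_mem_nhdsWithin, nhdsWithin_le_nhds (isOpen_Iio.mem_nhds hε)] with δ h1 h2
  exact h δ h1 h2

theorem saw_sum_eq_zero_of_generic [DecidableEq ι] {κ : ℝ} {o : ι} (hr : ∀ n, 0 < r n)
    (hmid : ∀ n (k : ℤ), |saw (k * (c n o / r n))| < κ → ∑ j, saw (k * (c n j / r n)) = 0)
    {h : ι → ℝ} (ha : Admissible U r c h) (hg : Generic U r c h) (ho : |saw (h o)| < κ) :
    ∑ j, saw (h j) = 0 := by
  refine abs_eq_zero.1 (le_antisymm ?_ (abs_nonneg _))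
  refine le_zero_of_forall_le_mul (d := Fintype.card ι) (sub_pos.2 ho)
    fun δ h0 h1 => ?_
  obtain ⟨n, k, hk⟩ := exists_saw_approx hr ha hg h0
  have h2 := abs_saw_sum_sub_le hk
  have h3 := abs_sub_abs_le_abs_sub (saw (k * (c n o / r n))) (saw (h o))
  rw [hmid n k (by linarith [hk o]), zero_sub, abs_neg] at h2
  exact h2

theorem saw_sum_nonpos_of_generic [DecidableEq ι] {o : ι} (hr : ∀ n, 0 < r n)
    (hneg : ∀ n (k : ℤ), saw (k * (c n o / r n)) < 0 → ∑ j, saw (k * (c n j / r n)) ≤ 0)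
    {h : ι → ℝ} (ha : Admissible U r c h) (hg : Generic U r c h) (ho : saw (h o) < 0) :
    ∑ j, saw (h j) ≤ 0 := by
  refine le_zero_of_forall_le_mul (d := Fintype.card ι) (neg_pos.2 ho)
    fun δ h0 h1 => ?_
  obtain ⟨n, k, hk⟩ := exists_saw_approx hr ha hg h0
  have h2 := (abs_le.1 (abs_saw_sum_sub_le hk)).1
  have h3 := hneg n k (by linarith [(abs_lt.1 (hk o)).2])
  linarith

theorem Admissible.add_mul {w : ι → ℤ} (hw : ∀ m ∈ relations U r c, ∑ j, m j * w j = 0)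
    {h : ι → ℝ} (ha : Admissible U r c h) (t : ℝ) :
    Admissible U r c fun j => h j + w j * t := by
  intro m hm
  obtain ⟨z, hz⟩ := ha m hm
  refine ⟨z, ?_⟩
  have h0 : ∑ j, (m j : ℝ) * w j = 0 := by exact_mod_cast hw m hm
  calc ∑ j, (m j : ℝ) * (h j + w j * t)
      = ∑ j, (m j : ℝ) * h j + (∑ j, (m j : ℝ) * w j) * t := by
        rw [Finset.sum_mul, ← Finset.sum_add_distrib]
        exact Finset.sum_congr rfl fun j _ => by ring
    _ = z := by rw [hz, h0]; ring

/-- Symmetric perturbation to generic points along an orthogonal direction. -/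
theorem exists_generic_symmetric [DecidableEq ι] {w : ι → ℤ}
    (hw : ∀ m ∈ relations U r c, ∑ j, m j * w j = 0)
    (hwg : ∀ j, w j ≠ 0 ∨ ∃ N : ℕ, 0 < N ∧ Pi.single j (N : ℤ) ∈ relations U r c)
    {h : ι → ℝ} (ha : Admissible U r c h) (S : Set ℝ) (hS : IsOpen S) {o : ι}
    (ho : ∀ z : ℤ, h o ≠ z) (hoS : saw (h o) ∈ S) :
    ∃ h₁ h₂ : ι → ℝ, Admissible U r c h₁ ∧ Admissible U r c h₂ ∧ Generic U r c h₁ ∧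
      Generic U r c h₂ ∧ saw (h₁ o) ∈ S ∧ saw (h₂ o) ∈ S ∧
      ∑ j, saw (h₁ j) + ∑ j, saw (h₂ j) = 2 * ∑ j, saw (h j) := by
  have hgen : ∀ s : ℝ, s ≠ 0 → ∀ᶠ t in 𝓝[>] (0 : ℝ),
      Generic U r c fun j => h j + w j * (s * t) := by
    intro s hs
    refine eventually_all.2 fun j => ?_
    rcases hwg j with hj | hj
    · have hj' : (w j * s : ℝ) ≠ 0 := mul_ne_zero (by exact_mod_cast hj) hs
      filter_upwards [eventually_add_mul_ne_int (h j) hj'] with t ht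
      left
      simpa only [mul_assoc] using ht
    · exact Eventually.of_forall fun t => Or.inr hj
  have hopen : ∀ s : ℝ, ∀ᶠ t in 𝓝[>] (0 : ℝ), saw (h o + w o * (s * t)) ∈ S := by
    intro s
    have hcont : ContinuousAt saw (h o) := by
      have h1 : Tendsto (fun y => saw (h o) + (y - h o)) (𝓝 (h o)) (𝓝 (saw (h o))) := by
        have : Continuous fun y : ℝ => saw (h o) + (y - h o) := by fun_prop
        simpa using this.tendsto (h o)
      exact h1.congr' ((saw_eventually_eq ho).mono fun y hy => hy.symm)
    have h2 := (tendsto_add_mul_nhds (h o) (w o * s)).mono_left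
      (nhdsWithin_le_nhds (s := Set.Ioi 0))
    have h3 := (hcont.tendsto.comp h2).eventually (hS.mem_nhds hoS)
    filter_upwards [h3] with t ht
    have e : h o + w o * (s * t) = h o + w o * s * t := by ring
    rw [e]; exact ht
  have hsym : ∀ᶠ t in 𝓝[>] (0 : ℝ), ∀ j, saw (h j + w j * t) + saw (h j - w j * t)
      = 2 * saw (h j) :=
    eventually_all.2 fun j => nhdsWithin_le_nhds (saw_add_saw_sub_eventually (h j) (w j))
  obtain ⟨t, g1, g2, o1, o2, hs⟩ := ((hgen 1 one_ne_zero).and ((hgen (-1) (by norm_num)).and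
    ((hopen 1).and ((hopen (-1)).and hsym)))).exists
  refine ⟨_, _, ha.add_mul hw _, ha.add_mul hw _, g1, g2, o1, o2, ?_⟩
  rw [← Finset.sum_add_distrib, Finset.mul_sum]
  refine Finset.sum_congr rfl fun j _ => ?_
  rw [← hs j]
  congr 2 <;> ring

end Relations

/-! ### The averaging contradiction and the resulting bound on $r$. -/

theorem not_sequence_of_saw_sums {ι : Type*} [Fintype ι] [DecidableEq ι] {ε : ℝ} (hε : 0 < ε)
    (o : ι) (r : ℕ → ℕ) (hr : ∀ n, n + 1 < r n) (c : ℕ → ι → ℤ) (hc : ∀ n, c n o = -1)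
    (hmid : ∀ n (k : ℤ), |saw (k * (c n o / r n))| < 1 / 3 + ε →
      ∑ j, saw (k * (c n j / r n)) = 0)
    (hneg : ∀ n (k : ℤ), saw (k * (c n o / r n)) < 0 → ∑ j, saw (k * (c n j / r n)) ≤ 0)
    (k : ℕ → ℤ) (hk : ∀ n, saw (k n * (c n o / r n)) < 0) :
    ∃ n, 0 ≤ ∑ j, saw (k n * (c n j / r n)) := by
  let U : Ultrafilter ℕ := hyperfilter ℕ
  have hr0 : ∀ n, 0 < r n := fun n => by have := hr n; omega
  -- A torsion relation in the coordinate `o` would give $r_n\mid N$ for almost all $n$, because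
  -- $c_{n,o}=-1$; this is impossible as $r_n\to\infty$.
  obtain ⟨w, hw, hwo, hwg⟩ := exists_orthogonal_generic (relations U r c) o (by
    intro N hN hmem
    have h1 := (mem_relations U r c).1 hmem
    have h2 : ∀ᶠ n in U, N ≤ n := Nat.hyperfilter_le_atTop (eventually_ge_atTop N)
    obtain ⟨n, hn1, hn2⟩ := (h1.and h2).exists
    rw [Finset.sum_eq_single o (fun i _ hi => by simp [hi]) (by simp)] at hn1
    simp only [Pi.single_eq_same, hc, mul_neg, mul_one, dvd_neg] at hn1
    have := Nat.le_of_dvd hN (by exact_mod_cast hn1)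
    have := hr n
    omega)
  have hzero : ∀ h : ι → ℝ, Admissible U r c h → (∀ z : ℤ, h o ≠ z) →
      |saw (h o)| < 1 / 3 + ε → ∑ j, saw (h j) = 0 := by
    intro h ha ho hs
    obtain ⟨h₁, h₂, a1, a2, g1, g2, s1, s2, e⟩ := exists_generic_symmetric hw hwg ha
      {x | |x| < 1 / 3 + ε} (isOpen_lt continuous_abs continuous_const) ho hs
    rw [saw_sum_eq_zero_of_generic hr0 hmid a1 g1 s1,
      saw_sum_eq_zero_of_generic hr0 hmid a2 g2 s2] at e
    linarith
  have hnonpos : ∀ h : ι → ℝ, Admissible U r c h → saw (h o) < 0 → ∑ j, saw (h j) ≤ 0 := by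
    intro h ha hs
    have ho : ∀ z : ℤ, h o ≠ z := by
      intro z hz; rw [hz, saw_int] at hs; exact lt_irrefl _ hs
    obtain ⟨h₁, h₂, a1, a2, g1, g2, s1, s2, e⟩ := exists_generic_symmetric hw hwg ha
      (Set.Iio 0) isOpen_Iio ho hs
    have := saw_sum_nonpos_of_generic hr0 hneg a1 g1 s1
    have := saw_sum_nonpos_of_generic hr0 hneg a2 g2 s2
    linarith
  obtain ⟨n, hn⟩ := (eventually_forall_relations U r c).exists
  refine ⟨n, ?_⟩
  by_contra hcon
  push Not at hcon
  obtain ⟨W, hW⟩ : ∃ W : ℕ, w o = W := ⟨(w o).toNat, by omega⟩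
  have hWpos : 0 < W := by omega
  have hWR : (W : ℝ) ≠ 0 := by exact_mod_cast hWpos.ne'
  have hqR : (r n : ℝ) ≠ 0 := by exact_mod_cast (hr0 n).ne'
  set b : ι → ℝ := fun j => k n * (c n j / r n) with hb
  -- A common denominator for the multiples of $b$ and for division by $W=w_o$.
  set Q : ℕ := r n * W with hQdef
  have hQ : 1 < Q := lt_of_lt_of_le (by have := hr n; omega) (Nat.le_mul_of_pos_right (r n) hWpos)
  have hQR : (Q : ℝ) = r n * W := by rw [hQdef]; push_cast; ring
  have hbad : ∀ m : ℕ, Admissible U r c fun j => m * b j := by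
    intro m v hv
    obtain ⟨l, hl⟩ := hn v hv
    have hl : ∑ j, (v j : ℝ) * c n j = r n * l := by exact_mod_cast hl
    refine ⟨m * k n * l, ?_⟩
    have e : ∀ j ∈ Finset.univ, (v j : ℝ) * (m * b j)
        = (v j : ℝ) * c n j * (m * k n / r n) := fun j _ => by rw [hb]; ring
    rw [Finset.sum_congr rfl e, ← Finset.sum_mul, hl]
    push_cast; field_simp
  -- The point $mb$ is moved along $w$ until its coordinate `o` equals $s+i$; different $i$ account
  -- for the ambiguity of division by $W$ modulo $1$.
  set x : ℝ → ℕ → ℕ → ι → ℝ := fun s m i j => m * b j + w j * ((s - m * b o + i) / W) with hx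
  have hxad : ∀ s m i, Admissible U r c (x s m i) := fun s m i => (hbad m).add_mul hw _
  have hxo : ∀ s m i, x s m i o = s + (i : ℤ) := by
    intro s m i
    simp only [hx, hW]
    push_cast
    field_simp; ring
  have hsum : ∀ j, ∃ (D : ℝ) (P : ℤ), ∀ s : ℝ, ∑ m ∈ Finset.range Q, ∑ i ∈ Finset.range Q,
      saw (x s m i j) = D * saw (P * s) := by
    intro j
    obtain ⟨D, P, hDP⟩ := exists_sum_sum_saw Q (by omega)
      (k n * c n j * W - w j * (k n * c n o)) (w j * r n) (w j / W)
      (by rw [hQR]; push_cast; field_simp)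
    refine ⟨D, P, fun s => ?_⟩
    rw [← hDP s]
    refine Finset.sum_congr rfl fun m _ => Finset.sum_congr rfl fun i _ => ?_
    congr 1
    simp only [hx, hb]
    rw [hQR]; push_cast; field_simp; ring
  choose D P hDP using hsum
  have hG : ∀ s : ℝ, ∑ m ∈ Finset.range Q, ∑ i ∈ Finset.range Q, ∑ j, saw (x s m i j)
      = ∑ j, D j * saw (P j * s) := by
    intro s
    simp only [← hDP]
    symm
    rw [Finset.sum_comm]
    exact Finset.sum_congr rfl fun m _ => Finset.sum_comm
  have hG0 := saw_sum_eq_zero_of_middle hε D P (fun s hs hs' => by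
    rw [← hG s]
    refine Finset.sum_eq_zero fun m _ => Finset.sum_eq_zero fun i _ => hzero _ (hxad s m i) ?_ ?_
    · intro z hz
      rw [hxo] at hz
      exact hs (z - i) (by push_cast; push_cast at hz; linarith)
    · rw [hxo, saw_add_int]; exact hs') (b o)
  rw [← hG] at hG0
  have hle : ∀ m i, ∑ j, saw (x (b o) m i j) ≤ 0 := fun m i =>
    hnonpos _ (hxad _ m i) (by rw [hxo, saw_add_int]; exact hk n)
  have h10 : x (b o) 1 0 = b := by
    ext j; simp [hx]
  have hlt : ∑ m ∈ Finset.range Q, ∑ i ∈ Finset.range Q, ∑ j, saw (x (b o) m i j) < 0 := by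
    refine Finset.sum_neg' (fun m _ => Finset.sum_nonpos fun i _ => hle m i)
      ⟨1, Finset.mem_range.2 hQ, Finset.sum_neg' (fun i _ => hle 1 i)
        ⟨0, Finset.mem_range.2 (by omega), ?_⟩⟩
    rw [h10]; exact hcon
  exact hlt.ne hG0

/-- If `∑ saw (k c_j / r)` vanishes for `-k / r` in the middle part of the unit interval and is
nonpositive in the upper half, and `c_o = -1`, then it vanishes in the upper half, for all large `r`. -/
theorem exists_bound_saw_sum {ι : Type*} [Fintype ι] [DecidableEq ι] {ε : ℝ} (hε : 0 < ε)
    (o : ι) : ∃ R : ℕ, ∀ r : ℕ, R < r → ∀ c : ι → ℤ, c o = -1 →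
      (∀ k : ℤ, |saw (k * (c o / r))| < 1 / 3 + ε → ∑ j, saw (k * (c j / r)) = 0) →
      (∀ k : ℤ, saw (k * (c o / r)) < 0 → ∑ j, saw (k * (c j / r)) ≤ 0) →
      ∀ k : ℤ, saw (k * (c o / r)) < 0 → 0 ≤ ∑ j, saw (k * (c j / r)) := by
  by_contra hcon
  push Not at hcon
  -- The shift by one guarantees $r_n\ge2$ already at $n=0$, so that the index $m=1$ is present in
  -- the average.
  choose r hr c hc hmid hneg k hk hlt using fun n : ℕ => hcon (n + 1)
  obtain ⟨n, hn⟩ := not_sequence_of_saw_sums hε o r hr c hc hmid hneg k hk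
  exact absurd hn (not_le.2 (hlt n))

/-! ### From fractional parts to sawtooth sums, and the conclusion. -/

theorem saw_eq_fract_sub {x : ℝ} (h : Int.fract x ≠ 0) : saw x = Int.fract x - 1 / 2 := by
  rw [saw, if_neg h]

theorem fract_div_eq_zero_iff {r : ℕ} (hr : 0 < r) (a : ℤ) :
    Int.fract ((a : ℝ) / r) = 0 ↔ (r : ℤ) ∣ a := by
  have hr' : (r : ℝ) ≠ 0 := by exact_mod_cast hr.ne'
  rw [Int.fract_eq_zero_iff]
  constructor
  · rintro ⟨z, hz⟩
    rw [eq_div_iff hr'] at hz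
    exact ⟨z, by rw [mul_comm]; exact_mod_cast hz.symm⟩
  · rintro ⟨z, rfl⟩
    exact ⟨z, by push_cast; field_simp⟩

theorem dvd_mul_iff_of_gcd_eq {r : ℕ} {a e : ℤ} (h : Int.gcd a r = Int.gcd e r) (k : ℤ) :
    (r : ℤ) ∣ a * k ↔ (r : ℤ) ∣ e * k := by
  rw [← Int.dvd_gcd_mul_iff_dvd_mul, Int.gcd_comm, h, Int.gcd_comm, Int.dvd_gcd_mul_iff_dvd_mul]

/-- The weights whose sawtooth sum records the discrepancy defect. -/
def weights (a₁ a₂ a₃ a₄ e : ℤ) : Fin 6 → ℤ := ![a₁, a₂, a₃, a₄, -e, -1]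

theorem saw_sum_add_mul (r : ℕ) (hr : 0 < r) {ι : Type*} [Fintype ι] (c : ι → ℤ) (k l : ℤ) :
    ∑ j, saw ((k + r * l : ℤ) * (c j / r)) = ∑ j, saw (k * (c j / r)) := by
  have hr' : (r : ℝ) ≠ 0 := by exact_mod_cast hr.ne'
  refine Finset.sum_congr rfl fun j _ => ?_
  rw [← saw_add_int (k * (c j / r)) (l * c j)]
  congr 1; push_cast; field_simp

theorem saw_sum_neg {ι : Type*} [Fintype ι] (x : ι → ℝ) (k : ℤ) :
    ∑ j, saw ((-k : ℤ) * x j) = -∑ j, saw (k * x j) := by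
  rw [← Finset.sum_neg_distrib]
  refine Finset.sum_congr rfl fun j _ => ?_
  rw [← saw_neg]; congr 1; push_cast; ring

/-- The three unit weights contribute $-\frac12$ each and the weight $-1$ contributes $+\frac12$, in
total $-1$. The corrections for $a_4$ and $-e$ cancel, since equal gcds make both arguments integral
at the same $k$. -/
theorem saw_sum_weights {r : ℕ} (hr : 0 < r) {a₁ a₂ a₃ a₄ e : ℤ}
    (h₁ : Int.gcd a₁ r = 1) (h₂ : Int.gcd a₂ r = 1) (h₃ : Int.gcd a₃ r = 1)
    (h₄ : Int.gcd a₄ r = Int.gcd e r) {k : ℕ} (hk1 : 1 ≤ k) (hkr : k < r) :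
    ∑ j, saw ((k : ℤ) * (weights a₁ a₂ a₃ a₄ e j / r))
      = Int.fract ((a₁ * k : ℝ) / r) + Int.fract ((a₂ * k : ℝ) / r)
        + Int.fract ((a₃ * k : ℝ) / r) + Int.fract ((a₄ * k : ℝ) / r)
        - Int.fract ((e * k : ℝ) / r) - k / r - 1 := by
  have hr' : (0 : ℝ) < r := by exact_mod_cast hr
  have hnd : ¬ (r : ℤ) ∣ (k : ℤ) := by
    intro h
    have := Nat.le_of_dvd (by omega) (Int.natCast_dvd_natCast.1 h)
    omega
  have hcast : ∀ a : ℤ, (a * k : ℝ) / r = ((a * k : ℤ) : ℝ) / r := fun a => by push_cast; ring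
  have hunit : ∀ a : ℤ, Int.gcd a r = 1 →
      saw ((a * k : ℝ) / r) = Int.fract ((a * k : ℝ) / r) - 1 / 2 := by
    intro a ha
    refine saw_eq_fract_sub fun h => hnd ?_
    rw [hcast, fract_div_eq_zero_iff hr] at h
    exact Int.dvd_of_dvd_mul_right_of_gcd_one h (by rw [Int.gcd_comm]; exact ha)
  have h45 : saw ((a₄ * k : ℝ) / r) - saw ((e * k : ℝ) / r)
      = Int.fract ((a₄ * k : ℝ) / r) - Int.fract ((e * k : ℝ) / r) := by
    have hiff : Int.fract ((a₄ * k : ℝ) / r) = 0 ↔ Int.fract ((e * k : ℝ) / r) = 0 := by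
      rw [hcast, hcast, fract_div_eq_zero_iff hr, fract_div_eq_zero_iff hr]
      exact dvd_mul_iff_of_gcd_eq h₄ k
    by_cases h : Int.fract ((a₄ * k : ℝ) / r) = 0
    · simp [saw, h, hiff.1 h]
    · rw [saw_eq_fract_sub h, saw_eq_fract_sub fun h' => h (hiff.2 h')]; ring
  have h6 : saw ((k : ℝ) / r) = k / r - 1 / 2 :=
    saw_of_mem_Ioo (div_pos (by exact_mod_cast hk1) hr')
      (by rw [div_lt_one hr']; exact_mod_cast hkr)
  have e' : ∀ a : ℤ, (((k : ℤ) : ℝ) * ((a : ℝ) / r)) = (a * k : ℝ) / r := fun a => by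
    push_cast; ring
  simp only [Fin.sum_univ_six, e']
  simp only [weights, Matrix.cons_val]
  have e5 : ((-e : ℤ) * k : ℝ) / r = -((e * k : ℝ) / r) := by push_cast; ring
  have e6 : ((-1 : ℤ) * k : ℝ) / r = -((k : ℝ) / r) := by push_cast; ring
  rw [e5, e6, saw_neg, saw_neg, hunit _ h₁, hunit _ h₂, hunit _ h₃, h6]
  linarith

theorem exists_int_eq_fract_sum {r : ℕ} (hr : 0 < r) {a₁ a₂ a₃ a₄ e : ℤ}
    (hs : a₁ + a₂ + a₃ + a₄ - e ≡ 1 [ZMOD r]) (k : ℕ) :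
    ∃ z : ℤ, Int.fract ((a₁ * k : ℝ) / r) + Int.fract ((a₂ * k : ℝ) / r)
        + Int.fract ((a₃ * k : ℝ) / r) + Int.fract ((a₄ * k : ℝ) / r)
        - Int.fract ((e * k : ℝ) / r) - k / r = z := by
  have hr' : (r : ℝ) ≠ 0 := by exact_mod_cast hr.ne'
  obtain ⟨l, hl⟩ := hs.symm.dvd
  have hl : (a₁ + a₂ + a₃ + a₄ - e - 1 : ℝ) = r * l := by exact_mod_cast hl
  refine ⟨l * k - ⌊(a₁ * k : ℝ) / r⌋ - ⌊(a₂ * k : ℝ) / r⌋ - ⌊(a₃ * k : ℝ) / r⌋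
    - ⌊(a₄ * k : ℝ) / r⌋ + ⌊(e * k : ℝ) / r⌋, ?_⟩
  have : (a₁ * k : ℝ) / r + (a₂ * k : ℝ) / r + (a₃ * k : ℝ) / r + (a₄ * k : ℝ) / r
      - (e * k : ℝ) / r - k / r = l * k := by
    have : (a₁ * k : ℝ) / r + (a₂ * k : ℝ) / r + (a₃ * k : ℝ) / r + (a₄ * k : ℝ) / r
      - (e * k : ℝ) / r - k / r = (a₁ + a₂ + a₃ + a₄ - e - 1 : ℝ) * k / r := by ring
    rw [this, hl]; field_simp
  simp only [Int.fract]
  push_cast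
  linarith

/-- The index `r` is bounded in terms of `ε` in all cases, so the first alternative always holds:
the sawtooth sum of the weights takes the value `-1` on `Γ`, which is impossible for large `r`. -/
theorem mainTheorem3 (ε : ℝ) (hε : ε ∈ Set.Ioo (0 : ℝ) (1 / 6)) :
    ∃ (Γ₀ : Finset ℕ) (M : ℕ), (∀ n ∈ Γ₀, 0 < n) ∧ 0 < M ∧
      ∀ (r : ℕ) (a₁ a₂ a₃ a₄ e : ℤ), 0 < r →
        Int.gcd a₁ r = 1 → Int.gcd a₂ r = 1 → Int.gcd a₃ r = 1 →
        Int.gcd a₄ r = Int.gcd e r →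
        a₁ + a₂ + a₃ + a₄ - e ≡ 1 [ZMOD r] →
        (a₁ + a₂ - e ≡ 0 [ZMOD r] ∨
          2 * a₄ - e ≡ 0 [ZMOD r] ∨
          (2 * a₁ - e ≡ 0 [ZMOD r] ∧ Int.gcd a₄ r ≤ 2 ∧ Int.gcd e r ≤ 2)) →
        ∀ Γ : Set ℕ, Γ.Nonempty → (∀ k ∈ Γ, 1 ≤ k ∧ k < r) →
          (∀ k ∈ Γ, (k : ℝ) / r ∈ Set.Ico (5 / 6 + ε) 1 ∧
            Int.fract ((a₁ * k : ℝ) / r) + Int.fract ((a₂ * k : ℝ) / r)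
              + Int.fract ((a₃ * k : ℝ) / r) + Int.fract ((a₄ * k : ℝ) / r)
              = Int.fract ((e * k : ℝ) / r) + (k : ℝ) / r) →
          (∀ k : ℕ, 1 ≤ k → k < r → k ∉ Γ →
            Int.fract ((a₁ * k : ℝ) / r) + Int.fract ((a₂ * k : ℝ) / r)
              + Int.fract ((a₃ * k : ℝ) / r) + Int.fract ((a₄ * k : ℝ) / r)
              > Int.fract ((e * k : ℝ) / r) + 1) →
          r ∈ Γ₀ ∨
            ((2 * a₄ - e ≡ 0 [ZMOD r] ∧ ¬ (a₁ + a₂ - e ≡ 0 [ZMOD r])) ∧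
              (7 ≤ Int.gcd e r ∧ Int.gcd e r ≤ M) ∧
              ∀ k ∈ Γ, (r : ℤ) ∣ e * k) := by
  obtain ⟨R, hR⟩ := exists_bound_saw_sum hε.1 (5 : Fin 6)
  -- The value $M=1$ is arbitrary: the first alternative is always the one proved.
  refine ⟨Finset.Icc 1 R, 1, fun n hn => (Finset.mem_Icc.1 hn).1, one_pos, ?_⟩
  intro r a₁ a₂ a₃ a₄ e hr h₁ h₂ h₃ h₄ hs _ Γ hΓ hΓr hΓin hΓout
  left
  rw [Finset.mem_Icc]
  refine ⟨hr, ?_⟩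
  by_contra hlarge
  have hr' : (0 : ℝ) < r := by exact_mod_cast hr
  set c := weights a₁ a₂ a₃ a₄ e with hc
  have hc5 : c 5 = -1 := by simp [hc, weights]
  set F : ℤ → ℝ := fun k => ∑ j, saw (k * (c j / r)) with hF
  have hsaw5 : ∀ k l : ℤ, saw ((k + r * l : ℤ) * ((c 5 : ℝ) / r)) = saw (-((k : ℝ) / r)) := by
    intro k l
    rw [← saw_add_int (-((k : ℝ) / r)) (-l), hc5]
    congr 1; push_cast; field_simp; ring
  have hsawk : ∀ k : ℕ, 1 ≤ k → k < r → saw (-((k : ℝ) / r)) = 1 / 2 - k / r := by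
    intro k h1 h2
    rw [saw_neg, saw_of_mem_Ioo (div_pos (by exact_mod_cast h1) hr')
      (by rw [div_lt_one hr']; exact_mod_cast h2)]
    ring
  have hFnonneg : ∀ k : ℕ, 1 ≤ k → k < r → k ∉ Γ → 0 ≤ F k := by
    intro k h1 h2 hk
    have e1 : F k = _ := saw_sum_weights hr h₁ h₂ h₃ h₄ h1 h2
    obtain ⟨z, hz⟩ := exists_int_eq_fract_sum hr hs k
    have hout := hΓout k h1 h2 hk
    have hlt : (k : ℝ) / r < 1 := by rw [div_lt_one hr']; exact_mod_cast h2
    -- The hypothesis gives only $z>1-k/r$; integrality raises this to $z\ge1$.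
    have hz0 : (0 : ℝ) < z := by rw [← hz]; linarith
    have hz1 : (1 : ℝ) ≤ z := by
      have : 0 < z := by exact_mod_cast hz0
      exact_mod_cast this
    rw [e1, hz]; linarith
  have hFper : ∀ k l : ℤ, F (k + r * l) = F k := fun k l => saw_sum_add_mul r hr c k l
  have hFrefl : ∀ k : ℕ, k < r → F ((r - k : ℕ) : ℤ) = -F k := by
    intro k hk
    have e1 : (((r - k : ℕ) : ℕ) : ℤ) = -(k : ℤ) + r * 1 := by omega
    rw [e1, hFper]
    exact saw_sum_neg _ _
  have hreflΓ : ∀ k : ℕ, k < r → 1 / 6 - ε < (k : ℝ) / r → r - k ∉ Γ := by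
    intro k hk hlt hmem
    have := (hΓin _ hmem).1.1
    rw [Nat.cast_sub hk.le, sub_div, div_self hr'.ne'] at this
    linarith
  have hdecomp : ∀ k : ℤ, ∃ (k' : ℕ) (l : ℤ), k' < r ∧ k = k' + r * l := by
    intro k
    have hrZ : (0 : ℤ) < r := by exact_mod_cast hr
    have h0 := Int.emod_nonneg k hrZ.ne'
    have h1 := Int.emod_lt_of_pos k hrZ
    refine ⟨(k % r).toNat, k / r, by omega, ?_⟩
    rw [Int.toNat_of_nonneg h0, Int.emod_add_mul_ediv]
  have hF0 : F ((0 : ℕ) : ℤ) = 0 := by simp [hF, saw_zero]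
  have hmid : ∀ k : ℤ, |saw (k * ((c 5 : ℝ) / r))| < 1 / 3 + ε → F k = 0 := by
    intro k hk
    obtain ⟨k', l, hk', rfl⟩ := hdecomp k
    rw [hsaw5, Int.cast_natCast] at hk
    rw [hFper]
    rcases Nat.eq_zero_or_pos k' with rfl | hpos
    · exact hF0
    · rw [hsawk k' hpos hk', abs_lt] at hk
      have h1 := hFnonneg k' hpos hk' fun hmem => by
        have := (hΓin _ hmem).1.1
        linarith [hk.1]
      -- In the middle neither $k'$ nor $r-k'$ lies in $\Gamma$, so oddness gives both signs.
      have h2 := hFnonneg (r - k') (by omega) (by omega) (hreflΓ k' hk' (by linarith [hk.2]))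
      rw [hFrefl k' hk'] at h2
      linarith
  have hneg : ∀ k : ℤ, saw (k * ((c 5 : ℝ) / r)) < 0 → F k ≤ 0 := by
    intro k hk
    obtain ⟨k', l, hk', rfl⟩ := hdecomp k
    rw [hsaw5, Int.cast_natCast] at hk
    rw [hFper]
    rcases Nat.eq_zero_or_pos k' with rfl | hpos
    · exact hF0.le
    · rw [hsawk k' hpos hk'] at hk
      have h2 := hFnonneg (r - k') (by omega) (by omega)
        (hreflΓ k' hk' (by linarith [hε.1]))
      rw [hFrefl k' hk'] at h2
      linarith
  obtain ⟨k, hk⟩ := hΓ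
  obtain ⟨hk1, hkr⟩ := hΓr k hk
  obtain ⟨⟨hk5, _⟩, hkeq⟩ := hΓin k hk
  have hFk : F k = _ := saw_sum_weights hr h₁ h₂ h₃ h₄ hk1 hkr
  have hsk : saw ((k : ℤ) * ((c 5 : ℝ) / r)) < 0 := by
    have := hsaw5 k 0
    rw [mul_zero, add_zero] at this
    rw [this, Int.cast_natCast, hsawk k hk1 hkr]
    linarith [hε.1]
  have hFk0 : 0 ≤ F k := hR r (by omega) c hc5 hmid hneg k hsk
  rw [hFk] at hFk0
  linarith
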